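/- Let $q\equiv 3\pmod 4$ be a power of a prime $p$, let $\mathbb F_q\subset\mathbb F_{q^2}$ be the fields with $q$ and $q^2$ elements, and let $N:\mathbb F_{q^2}\to\mathbb F_q$, $N(z)=z^{q+1}$, be the norm. Multiplicative characters are complex-valued and extended by $0$ at $0$, the trivial one included; $\varepsilon$ and $\phi$ denote the trivial and the quadratic character of $\mathbb F_q$, and $\overline{D}$ is the complex conjugate (inverse) of $D$. For a character $C$ on $\mathbb F_q$, $CN$ denotes the character $C\circ N$ on $\mathbb F_{q^2}$. Let $M_8$ be a character of order $8$ on $\mathbb F_{q^2}$. Put $$\psi(y)=\exp\Big(\frac{2\pi i}{p}\big(y^p+y^{p^2}+\dots+y^q\big)\Big),\qquad G(A)=\sum_{y\in\mathbb F_q}A(y)\psi(y),$$ for characters $A$ on $\mathbb F_q$, and $J_2(\alpha,\beta)=\sum_{z\in\mathbb F_{q^2}}\alpha(z)\beta(1-z)$ for characters $\alpha,\beta$ on $\mathbb F_{q^2}$. For a character $D$ on $\mathbb F_q$ and $j\in\mathbb F_q^*$, define $$h(D,j)=\sum_{x\in\mathbb F_q^*}D(x)\,\phi(1-x)\,\phi\overline{D}^2\big(x(j+1)^2+(j-1)^2\big).$$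 Let $\nu_1$ be any character on $\mathbb F_q$, and define $$W(D)=\sum_{j\in\mathbb F_q^*}\phi\nu_1^4(j)\,h(D,j).$$ **Theorem 5.3.** We have $W(\varepsilon)=2$, and for every nontrivial character $D$ on $\mathbb F_q$, $$W(D)=\frac{-G(\phi)G(D)^2}{q\,G(\phi D^2)}\Big\{J_2\big((\nu_1N)M_8,\ \overline{D}N\big)+J_2\big((\nu_1N)M_8^5,\ \overline{D}N\big)\Big\}.$$ -/

import Mathlib

/-- The additive character `ψ(y) = exp((2πi/p) · Tr(y))` on a finite field `F` of
characteristic `p`, where `Tr(y) = y ^ p + y ^ (p ^ 2) + ⋯ + y ^ q` is the absolute trace. -/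
noncomputable def psi (p : ℕ) [Fact p.Prime] (F : Type*) [Field F] [Algebra (ZMod p) F] :
    AddChar F ℂ :=
  (ZMod.stdAddChar (N := p)).compAddMonoidHom
    (Algebra.trace (ZMod p) F : F →ₗ[ZMod p] ZMod p).toAddMonoidHom

/-- The Gauss sum `G(A) = ∑ y, A(y) ψ(y)` over `F`. -/
noncomputable def gaussG (p : ℕ) [Fact p.Prime] {F : Type*} [Field F] [Fintype F]
    [Algebra (ZMod p) F] (A : MulChar F ℂ) : ℂ :=
  gaussSum A (psi p F)

/-- The quadratic character `φ` of `F`, with complex values. -/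
noncomputable def phi (F : Type*) [Field F] [Fintype F] [DecidableEq F] : MulChar F ℂ :=
  (quadraticChar F).ringHomComp (Int.castRingHom ℂ)

/-- For a character `C` on `F`, the character `CN` on a finite extension `K`, obtained by
composing `C` with the norm map from `K` to `F`. -/
noncomputable def normChar {F : Type*} [Field F] (K : Type*) [Field K] [Algebra F K]
    [FiniteDimensional F K] (C : MulChar F ℂ) : MulChar K ℂ where
  toMonoidHom := (C : F →* ℂ).comp (Algebra.norm F : K →* F)
  map_nonunit' z hz := by
    have h0 : z = 0 := by simpa using hz
    subst h0
    simpa using C.map_zero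

/-- The character sum
`h(D, j) = ∑_{x ∈ F^*} D(x) φ(1 - x) (φ D̄²)(x (j + 1)² + (j - 1)²)`.
The conjugate character `D̄` is the inverse of `D` in the group of characters. -/
noncomputable def hSum {F : Type*} [Field F] [Fintype F] [DecidableEq F]
    (D : MulChar F ℂ) (j : Fˣ) : ℂ :=
  ∑ x : Fˣ, D x * phi F (1 - x) *
    (phi F * D⁻¹ ^ 2) (x * ((j : F) + 1) ^ 2 + ((j : F) - 1) ^ 2)

/-- The weighted sum `W(D) = ∑_{j ∈ F^*} (φ ν₁⁴)(j) h(D, j)`. -/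
noncomputable def wSum {F : Type*} [Field F] [Fintype F] [DecidableEq F]
    (ν₁ D : MulChar F ℂ) : ℂ :=
  ∑ j : Fˣ, (phi F * ν₁ ^ 4) j * hSum D j

/-! For nontrivial `D` the identity holds term by term in `j`, once the Jacobi sums are written as a
sum over `j`. Let S(j) be the sum over x of φ(x) D̄((1+j²)² − 4(2x−j)²). Up to Gauss sums, h(D,j)
and S(j) both expand into one double exponential sum (`gaussSum_mul_hSum`, `gaussSum_sq_mul_sum`);
comparing them gives `hSum_eq`. On the other side, M₈⁴ is quadratic, so the two Jacobi sums combine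
over squares. Frobenius symmetry then turns twice the result into a sum over fourth powers
(`jacobiSum_add_jacobiSum`). In coordinates x + yi its summand depends on x², y² only, symmetrically
and oddly, so it collapses to the weighted sum of S(j) with j = x + y (`sum_sum_odd_symmetric`). For
trivial `D`, only j = ±1 contribute. -/

/-! ### Preliminaries on characters. -/

theorem psi_isPrimitive (p : ℕ) [Fact p.Prime] (F : Type*) [Field F] [Fintype F]
    [Algebra (ZMod p) F] : (psi p F).IsPrimitive := by
  refine AddChar.IsPrimitive.of_ne_one fun h => ?_
  have hchar : CharP F p := charP_of_injective_algebraMap (algebraMap (ZMod p) F).injective p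
  obtain ⟨b, hb⟩ : ∃ b : F, Algebra.trace (ZMod p) F b ≠ 0 := by
    obtain rfl := ringChar.eq F p
    simpa using FiniteField.trace_to_zmod_nondegenerate F (a := 1) one_ne_zero
  have h1 : ZMod.stdAddChar (N := p) (Algebra.trace (ZMod p) F b) = 1 := by
    simpa [psi] using DFunLike.congr_fun h b
  exact hb (ZMod.injective_stdAddChar (by rw [h1, AddChar.map_zero_eq_one]))

/-- Nontriviality of χ makes this hold at y = 0 too, where both sides vanish. -/
theorem sum_mulChar_mul_addChar {F : Type*} [Field F] [Fintype F] {χ : MulChar F ℂ} (hχ : χ ≠ 1)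
    (ψ : AddChar F ℂ) (y : F) : ∑ s, χ s * ψ (y * s) = χ⁻¹ y * gaussSum χ ψ := by
  rcases eq_or_ne y 0 with rfl | hy
  · simpa [MulChar.map_zero] using MulChar.sum_eq_zero_of_ne_one hχ
  · simpa [gaussSum] using gaussSum_mulShift_eq χ ψ (Units.mk0 y hy)

theorem sum_units_eq_sum {F M : Type*} [Field F] [Fintype F] [DecidableEq F] [AddCommMonoid M]
    (f : F → M) (h0 : f 0 = 0) : ∑ x : Fˣ, f x = ∑ x, f x := by
  rw [← Finset.sum_erase Finset.univ h0]
  refine Finset.sum_bij (fun x _ => (x : F)) (by simp) (fun a _ b _ h => Units.ext h)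
    (fun b hb => ⟨Units.mk0 b (by simpa using hb), by simp⟩) (by simp)

theorem ringChar_ne_two_of_card {F : Type*} [Field F] [Fintype F]
    (hq : Fintype.card F % 4 = 3) : ringChar F ≠ 2 := fun h => by
  have := FiniteField.even_card_of_char_two h
  omega

theorem mulChar_pow_two_mul_apply_neg {F : Type*} [Field F] (χ : MulChar F ℂ) (n : ℕ) (a : F) :
    (χ ^ (2 * n)) (-a) = (χ ^ (2 * n)) a := by
  rw [neg_eq_neg_one_mul, map_mul]
  have : (χ ^ (2 * n)) (-1) = 1 := by
    have := MulChar.pow_apply_coe χ (2 * n) (-1)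
    rw [Units.val_neg, Units.val_one] at this
    rw [this, ← map_pow]; simp
  rw [this, one_mul]

/-! ### The quadratic character. -/

section Quadratic

variable {F : Type*} [Field F] [Fintype F] [DecidableEq F]

theorem phi_isQuadratic : (phi F).IsQuadratic :=
  (quadraticChar_isQuadratic F).comp _

theorem phi_sq : phi F ^ 2 = 1 := phi_isQuadratic.sq_eq_one

theorem phi_ne_one (hF : ringChar F ≠ 2) : phi F ≠ 1 :=
  (MulChar.ringHomComp_ne_one_iff Int.cast_injective).2 (quadraticChar_ne_one hF)

theorem phi_apply_sq {a : F} (ha : a ≠ 0) : phi F (a ^ 2) = 1 := by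
  simp [phi, quadraticChar_sq_one' ha]

theorem phi_mul_self {a : F} (ha : a ≠ 0) : phi F a * phi F a = 1 := by
  rw [← map_mul, ← sq, phi_apply_sq ha]

theorem phi_of_not_isSquare {a : F} (ha : ¬IsSquare a) : phi F a = -1 := by
  simp [phi, quadraticChar_neg_one_iff_not_isSquare.2 ha]

theorem sum_comp_sq (hF : ringChar F ≠ 2) (f : F → ℂ) :
    ∑ x, f (x ^ 2) = ∑ y, (1 + phi F y) * f y := by
  rw [← Finset.sum_fiberwise Finset.univ (fun x : F => x ^ 2)]
  refine Finset.sum_congr rfl fun y _ => ?_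
  rw [Finset.sum_congr rfl (g := fun _ => f y)
    (fun x hx => by rw [(Finset.mem_filter.1 hx).2]), Finset.sum_const, nsmul_eq_mul]
  congr 1
  have h := quadraticChar_card_sqrts hF y
  have h' : ({x : F | x ^ 2 = y}.toFinset) = Finset.univ.filter fun x : F => x ^ 2 = y := by
    ext; simp
  rw [h'] at h
  rw [← Int.cast_natCast, h]
  simp [phi, add_comm]

/-- χ is 1 on squares. A product of two nonsquares is a square, so the value 1 at a single nonsquare
would make χ trivial. -/
theorem eq_phi_of_sq_eq_one {χ : MulChar F ℂ} (h2 : χ ^ 2 = 1)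
    (h1 : χ ≠ 1) : χ = phi F := by
  have hsq : ∀ b : F, b ≠ 0 → χ (b ^ 2) = 1 := fun b hb => by
    rw [map_pow, ← MulChar.pow_apply' χ two_ne_zero, h2, MulChar.one_apply hb.isUnit]
  ext a
  by_cases ha : IsSquare (a : F)
  · obtain ⟨b, hb⟩ := ha
    have hb0 : b ≠ 0 := by rintro rfl; simp at hb
    rw [hb, ← sq, hsq b hb0, phi_apply_sq hb0]
  · rw [phi_of_not_isSquare ha]
    have h := hsq a a.ne_zero
    rw [map_pow, sq_eq_one_iff] at h
    refine h.resolve_left fun h => h1 ?_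
    ext b
    rw [MulChar.one_apply_coe]
    by_cases hb : IsSquare (b : F)
    · obtain ⟨c, hc⟩ := hb
      have hc0 : c ≠ 0 := by rintro rfl; simp at hc
      rw [hc, ← sq, hsq c hc0]
    · have : IsSquare ((a : F) * b) := by
        rw [← quadraticChar_one_iff_isSquare (by simp), map_mul,
          quadraticChar_neg_one_iff_not_isSquare.2 ha, quadraticChar_neg_one_iff_not_isSquare.2 hb]
        norm_num
      obtain ⟨c, hc⟩ := this
      have hc0 : c ≠ 0 := by rintro rfl; simp at hc
      have h3 := hsq c hc0
      rwa [sq, ← hc, map_mul, h, one_mul] at h3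

theorem phi_neg_one (hq : Fintype.card F % 4 = 3) : phi F (-1) = -1 :=
  phi_of_not_isSquare fun h => FiniteField.isSquare_neg_one_iff.1 h hq

theorem phi_neg (hq : Fintype.card F % 4 = 3) (a : F) : phi F (-a) = -phi F a := by
  rw [neg_eq_neg_one_mul, map_mul, phi_neg_one hq, neg_one_mul]

/-! ### Gauss sum evaluation of h(D, j). -/

theorem phi_mul_sq_ne_one (hq : Fintype.card F % 4 = 3) (D : MulChar F ℂ) :
    phi F * D ^ 2 ≠ 1 := fun h => by
  have h1 : (phi F * D ^ 2) (-1) = 1 := by rw [h]; exact MulChar.one_apply (by simp)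
  rw [MulChar.mul_apply, phi_neg_one hq, show D ^ 2 = D ^ (2 * 1) from rfl,
    mulChar_pow_two_mul_apply_neg D 1, map_one] at h1
  norm_num at h1

/-- Gauss sum expansion of `hSum` as a symmetric double sum. -/
theorem gaussSum_mul_hSum (hq : Fintype.card F % 4 = 3) (ψ : AddChar F ℂ) (D : MulChar F ℂ)
    (j : Fˣ) :
    gaussSum (phi F * D ^ 2) ψ * hSum D j = ∑ v : F, ∑ u : F, D u * D v * phi F (v - u) *
      ψ (u * ((j : F) + 1) ^ 2 + v * ((j : F) - 1) ^ 2) := by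
  have hinv : (phi F * D ^ 2)⁻¹ = phi F * D⁻¹ ^ 2 := by
    rw [mul_inv, phi_isQuadratic.inv, inv_pow]
  rw [hSum, sum_units_eq_sum (fun x => D x * phi F (1 - x) *
    (phi F * D⁻¹ ^ 2) (x * ((j : F) + 1) ^ 2 + ((j : F) - 1) ^ 2)) (by simp [MulChar.map_zero]),
    Finset.mul_sum]
  have : ∀ x : F, gaussSum (phi F * D ^ 2) ψ * (D x * phi F (1 - x) *
      (phi F * D⁻¹ ^ 2) (x * ((j : F) + 1) ^ 2 + ((j : F) - 1) ^ 2)) =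
      ∑ v, D x * phi F (1 - x) * ((phi F * D ^ 2) v *
        ψ ((x * ((j : F) + 1) ^ 2 + ((j : F) - 1) ^ 2) * v)) := fun x => by
    rw [← Finset.mul_sum, sum_mulChar_mul_addChar (phi_mul_sq_ne_one hq D), hinv]
    ring
  rw [Finset.sum_congr rfl fun x _ => this x, Finset.sum_comm]
  refine Finset.sum_congr rfl fun v _ => ?_
  rcases eq_or_ne v 0 with rfl | hv
  · simp [MulChar.map_zero]
  -- Substitute u = xv.
  rw [← Equiv.sum_comp (Equiv.mulRight₀ v hv) fun u => D u * D v * phi F (v - u) *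
    ψ (u * ((j : F) + 1) ^ 2 + v * ((j : F) - 1) ^ 2)]
  refine Finset.sum_congr rfl fun x _ => ?_
  simp only [Equiv.mulRight₀_apply]
  rw [show v - x * v = (1 - x) * v by ring, map_mul D, map_mul (phi F),
    MulChar.mul_apply, MulChar.pow_apply' D two_ne_zero,
    show x * v * ((j : F) + 1) ^ 2 + v * ((j : F) - 1) ^ 2 =
      (x * ((j : F) + 1) ^ 2 + ((j : F) - 1) ^ 2) * v by ring]
  ring

/-- The argument of D̄ factors as ((j−1)² + 4x)((j+1)² − 4x). Each factor is expanded by one Gauss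
sum of D; the sum over x is then a Gauss sum of φ at 4(v−u). -/
theorem gaussSum_sq_mul_sum (hq : Fintype.card F % 4 = 3) (ψ : AddChar F ℂ) {D : MulChar F ℂ}
    (hD : D ≠ 1) (j : F) :
    gaussSum D ψ ^ 2 * ∑ x : F, phi F x * D⁻¹ ((1 + j ^ 2) ^ 2 - 4 * (2 * x - j) ^ 2) =
      gaussSum (phi F) ψ * ∑ v : F, ∑ u : F, D u * D v * phi F (v - u) *
        ψ (u * (j + 1) ^ 2 + v * (j - 1) ^ 2) := by
  have hF := ringChar_ne_two_of_card hq
  have h4 : phi F 4 = 1 := by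
    rw [show (4 : F) = 2 ^ 2 by norm_num, phi_apply_sq (Ring.two_ne_zero hF)]
  have key : ∀ x : F, gaussSum D ψ ^ 2 * (phi F x * D⁻¹ ((1 + j ^ 2) ^ 2 - 4 * (2 * x - j) ^ 2)) =
      ∑ v, ∑ u, D u * D v * ψ (u * (j + 1) ^ 2 + v * (j - 1) ^ 2) *
        (phi F x * ψ (4 * (v - u) * x)) := fun x => by
    rw [show (1 + j ^ 2) ^ 2 - 4 * (2 * x - j) ^ 2 =
      ((j - 1) ^ 2 + 4 * x) * ((j + 1) ^ 2 - 4 * x) by ring, map_mul]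
    calc _ = phi F x * ((D⁻¹ ((j - 1) ^ 2 + 4 * x) * gaussSum D ψ) *
          (D⁻¹ ((j + 1) ^ 2 - 4 * x) * gaussSum D ψ)) := by ring
      _ = _ := by
        rw [← sum_mulChar_mul_addChar hD, ← sum_mulChar_mul_addChar hD, Finset.sum_mul_sum,
          Finset.mul_sum]
        refine Finset.sum_congr rfl fun v _ => ?_
        rw [Finset.mul_sum]
        refine Finset.sum_congr rfl fun u _ => ?_
        calc _ = phi F x * D u * D v *
              (ψ (((j - 1) ^ 2 + 4 * x) * v) * ψ (((j + 1) ^ 2 - 4 * x) * u)) := by ring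
          _ = phi F x * D u * D v *
              (ψ (u * (j + 1) ^ 2 + v * (j - 1) ^ 2) * ψ (4 * (v - u) * x)) := by
            rw [← AddChar.map_add_eq_mul, ← AddChar.map_add_eq_mul]; ring_nf
          _ = _ := by ring
  rw [Finset.mul_sum, Finset.sum_congr rfl fun x _ => key x, Finset.sum_comm, Finset.mul_sum]
  refine Finset.sum_congr rfl fun v _ => ?_
  rw [Finset.sum_comm, Finset.mul_sum]
  refine Finset.sum_congr rfl fun u _ => ?_
  rw [← Finset.mul_sum, sum_mulChar_mul_addChar (phi_ne_one hF), phi_isQuadratic.inv, map_mul, h4]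
  ring

theorem hSum_eq (hq : Fintype.card F % 4 = 3) {ψ : AddChar F ℂ} (hψ : ψ.IsPrimitive)
    {D : MulChar F ℂ} (hD : D ≠ 1) (j : Fˣ) :
    hSum D j = -(gaussSum (phi F) ψ * gaussSum D ψ ^ 2) /
      ((Fintype.card F : ℂ) * gaussSum (phi F * D ^ 2) ψ) *
        ∑ x : F, phi F x * D⁻¹ ((1 + (j : F) ^ 2) ^ 2 - 4 * (2 * x - j) ^ 2) := by
  have hc : (Fintype.card F : ℂ) ≠ 0 := by simp
  have hG := gaussSum_ne_zero_of_nontrivial hc (phi_mul_sq_ne_one hq D) hψ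
  have hsq := gaussSum_sq (phi_ne_one (ringChar_ne_two_of_card hq)) phi_isQuadratic hψ
  rw [phi_neg_one hq] at hsq
  have h := gaussSum_sq_mul_sum hq ψ hD (j : F)
  rw [← gaussSum_mul_hSum hq ψ D j] at h
  rw [div_mul_eq_mul_div, eq_div_iff (mul_ne_zero hc hG)]
  -- The minus sign comes from G(φ)² = φ(−1)q = −q.
  linear_combination gaussSum (phi F) ψ * h +
    gaussSum (phi F * D ^ 2) ψ * hSum D j * hsq

/-! ### The trivial character. -/

/-- With 1 − x = ky, k = (a² + c)/a², this becomes J(φ, φ) = −φ(−1). -/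
theorem sum_phi_mul_phi_linear (hq : Fintype.card F % 4 = 3) {a c : F} (ha : a ≠ 0)
    (hac : a ^ 2 + c ≠ 0) : ∑ x, phi F (1 - x) * phi F (x * a ^ 2 + c) = 1 := by
  have h := jacobiSum_nontrivial_inv (phi_ne_one (ringChar_ne_two_of_card hq))
  rw [phi_isQuadratic.inv, phi_neg_one hq, neg_neg, jacobiSum] at h
  rw [← h]
  have hk : (a ^ 2 + c) / a ^ 2 ≠ 0 := div_ne_zero hac (pow_ne_zero _ ha)
  rw [← (Equiv.subLeft (1 : F)).sum_comp, ← Equiv.sum_comp (Equiv.mulLeft₀ _ hk) fun x =>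
    phi F (1 - Equiv.subLeft 1 x) * phi F (Equiv.subLeft 1 x * a ^ 2 + c)]
  refine Finset.sum_congr rfl fun y _ => ?_
  simp only [Equiv.subLeft_apply, Equiv.mulLeft₀_apply, sub_sub_cancel]
  have : (1 - (a ^ 2 + c) / a ^ 2 * y) * a ^ 2 + c = (a ^ 2 + c) * (1 - y) := by
    field_simp; ring
  rw [this, div_eq_mul_inv, map_mul, map_mul, map_mul, ← inv_pow, phi_apply_sq (inv_ne_zero ha),
    mul_one]
  linear_combination phi F y * phi F (1 - y) * phi_mul_self hac

theorem hSum_one (j : Fˣ) :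
    hSum (1 : MulChar F ℂ) j =
      (∑ x, phi F (1 - x) * phi F (x * ((j : F) + 1) ^ 2 + ((j : F) - 1) ^ 2)) -
        phi F (((j : F) - 1) ^ 2) := by
  rw [eq_sub_iff_add_eq, ← Finset.sum_erase_add _ _ (Finset.mem_univ (0 : F))]
  congr 1
  · have := sum_units_eq_sum (fun x : F => (1 : MulChar F ℂ) x * phi F (1 - x) *
      (phi F * (1 : MulChar F ℂ)⁻¹ ^ 2) (x * ((j : F) + 1) ^ 2 + ((j : F) - 1) ^ 2))
      (by simp [MulChar.map_zero])
    rw [hSum, this, ← Finset.sum_erase Finset.univ (a := (0 : F)) (by simp [MulChar.map_zero])]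
    refine Finset.sum_congr rfl fun x hx => ?_
    rw [MulChar.one_apply (Finset.ne_of_mem_erase hx).isUnit]
    simp
  · simp

theorem wSum_one (hq : Fintype.card F % 4 = 3) (ν : MulChar F ℂ) : wSum ν 1 = 2 := by
  have hF := ringChar_ne_two_of_card hq
  have h2 : (2 : F) ≠ 0 := Ring.two_ne_zero hF
  have h4 : (4 : F) ≠ 0 := by rw [show (4 : F) = 2 ^ 2 by norm_num]; exact pow_ne_zero _ h2
  have hns : ∀ x : F, x ^ 2 + 1 ≠ 0 := fun x hx => by
    refine FiniteField.isSquare_neg_one_iff.1 ⟨x, ?_⟩ hq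
    linear_combination -hx
  have hp : hSum (1 : MulChar F ℂ) 1 = 1 := by
    rw [hSum_one, sum_phi_mul_phi_linear hq]
    · simp [MulChar.map_zero]
    · norm_num [h2]
    · norm_num [h4]
  have hm : hSum (1 : MulChar F ℂ) (-1) = -1 := by
    have h0 : ∑ x : F, phi F (1 - x) = 0 := by
      exact ((Equiv.subLeft (1 : F)).sum_comp (phi F)).trans
        (MulChar.sum_eq_zero_of_ne_one (phi_ne_one hF))
    have h22 : phi F ((-1 - 1) ^ 2) = 1 := phi_apply_sq (by norm_num [h2])
    rw [hSum_one]
    simp only [Units.val_neg, Units.val_one, h22, neg_add_cancel, ne_eq, OfNat.ofNat_ne_zero,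
      not_false_eq_true, zero_pow, mul_zero, zero_add, mul_one, h0, zero_sub]
  have h : ∀ j : Fˣ, j ≠ 1 → j ≠ -1 → hSum (1 : MulChar F ℂ) j = 0 := fun j h1 h1' => by
    have e1 : (j : F) - 1 ≠ 0 := fun h => h1 (Units.ext (by simpa using sub_eq_zero.1 h))
    have e2 : (j : F) + 1 ≠ 0 := fun h => h1' (Units.ext (by
      simpa using eq_neg_of_add_eq_zero_left h))
    rw [hSum_one, sum_phi_mul_phi_linear hq e2, phi_apply_sq e1, sub_self]
    rw [show ((j : F) + 1) ^ 2 + ((j : F) - 1) ^ 2 = 2 * ((j : F) ^ 2 + 1) by ring]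
    -- j² + 1 ≠ 0 because −1 is not a square in F.
    exact mul_ne_zero h2 (hns j)
  have hne : (1 : Fˣ) ≠ -1 := fun h => h2 (by
    have := congrArg Units.val h
    rw [Units.val_neg, Units.val_one] at this
    linear_combination this)
  have hν : (phi F * ν ^ 4) (-1) = -1 := by
    rw [MulChar.mul_apply, phi_neg_one hq, show ν ^ 4 = ν ^ (2 * 2) from rfl,
      mulChar_pow_two_mul_apply_neg, map_one, mul_one]
  rw [wSum, Finset.sum_eq_add_of_mem 1 (-1) (Finset.mem_univ _) (Finset.mem_univ _) hne
    (fun j _ hj => by rw [h j hj.1 hj.2, mul_zero]), hp, hm, Units.val_neg, Units.val_one, hν,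
    map_one]
  norm_num

end Quadratic

/-! ### Octic characters and Jacobi sums on the quadratic extension. -/

theorem card_eq_sq_of_finrank_eq_two {F K : Type*} [Field F] [Fintype F] [Field K] [Fintype K]
    [Algebra F K] (hK : Module.finrank F K = 2) : Fintype.card K = Fintype.card F ^ 2 := by
  rw [Module.card_eq_pow_finrank (K := F), hK]

theorem algebraMap_norm_eq_pow_card_add_one {F K : Type*} [Field F] [Fintype F] [Field K]
    [Fintype K] [Algebra F K] (hK : Module.finrank F K = 2) (w : K) :
    algebraMap F K (Algebra.norm F w) = w ^ (Fintype.card F + 1) := by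
  rw [FiniteField.algebraMap_norm_eq_pow_sum, hK]
  simp [Finset.sum_range_succ, add_comm]

theorem normChar_apply {F K : Type*} [Field F] [Field K] [Algebra F K]
    [FiniteDimensional F K] (C : MulChar F ℂ) (z : K) : normChar K C z = C (Algebra.norm F z) := rfl

theorem ringChar_ne_two_of_algebra {F K : Type*} [Field F] [Field K] [Algebra F K]
    (hF : ringChar F ≠ 2) : ringChar K ≠ 2 := by
  rwa [← Algebra.ringChar_eq F K]

/-- Elements of F* are norms z^(q+1), and 8 divides 2(q+1). -/
theorem sq_apply_algebraMap {F K : Type*} [Field F] [Fintype F] [Field K] [Fintype K]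
    [Algebra F K] (hq : Fintype.card F % 4 = 3) (hK : Module.finrank F K = 2)
    {M : MulChar K ℂ} (hM : orderOf M = 8) {a : F} (ha : a ≠ 0) :
    (M ^ 2) (algebraMap F K a) = 1 := by
  obtain ⟨z, rfl⟩ := FiniteField.norm_surjective F K a
  have hz0 : z ≠ 0 := by rintro rfl; simp at ha
  obtain ⟨k, hk⟩ : 4 ∣ Fintype.card F + 1 := by omega
  rw [algebraMap_norm_eq_pow_card_add_one hK, map_pow, MulChar.pow_apply' _ two_ne_zero, ← pow_mul,
    hk, ← mul_assoc, show 2 * 4 = 8 from rfl, pow_mul, ← MulChar.pow_apply' _ (by norm_num), ← hM,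
    pow_orderOf_eq_one, MulChar.one_apply hz0.isUnit, one_pow]

theorem pow_four_eq_phi {K : Type*} [Field K] [Fintype K] [DecidableEq K] {M : MulChar K ℂ}
    (hM : orderOf M = 8) : M ^ 4 = phi K := by
  refine eq_phi_of_sq_eq_one ?_ fun h => ?_
  · rw [← pow_mul, show 4 * 2 = orderOf M from hM.symm, pow_orderOf_eq_one]
  · have := orderOf_dvd_of_pow_eq_one h
    rw [hM] at this
    norm_num at this

/-- The Frobenius conjugate of `w` multiplies the quartic character by the quadratic one. -/
theorem sq_apply_frobenius {F K : Type*} [Field F] [Fintype F] [Field K] [Fintype K] [Algebra F K]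
    [DecidableEq K] (hq : Fintype.card F % 4 = 3) (hK : Module.finrank F K = 2) {M : MulChar K ℂ} (hM : orderOf M = 8) (w : K) :
    (M ^ 2) (w ^ Fintype.card F) = (M ^ 2) w * phi K w := by
  rcases eq_or_ne w 0 with rfl | hw
  · simp [MulChar.map_zero, zero_pow Fintype.card_ne_zero]
  have hN : Algebra.norm F w ≠ 0 := by simpa using hw
  have h1 := sq_apply_algebraMap hq hK hM hN
  rw [algebraMap_norm_eq_pow_card_add_one hK, pow_succ w, map_mul] at h1
  have h2 : (M ^ 2) w * (M ^ 2) w = phi K w := by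
    rw [← pow_four_eq_phi hM, ← MulChar.mul_apply, ← pow_add]
  have h3 := phi_mul_self hw
  have h0 : (M ^ 2) w ≠ 0 := (hw.isUnit.map (M ^ 2)).ne_zero
  apply mul_right_cancel₀ h0
  -- M²(w^q) inverts M²(w), and M²(w)² = φ(w) = ±1.
  linear_combination h1 - phi K w * h2 - h3

section Extension

variable {F K : Type*} [Field F] [Fintype F] [DecidableEq F] [Field K] [Fintype K] [Algebra F K]

theorem normChar_phi [DecidableEq K] (hF : ringChar F ≠ 2) : normChar K (phi F) = phi K := by
  refine eq_phi_of_sq_eq_one ?_ fun h => phi_ne_one hF ?_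
  · ext z
    rw [MulChar.pow_apply_coe, normChar_apply, ← MulChar.pow_apply' _ two_ne_zero, phi_sq,
      MulChar.one_apply_coe, MulChar.one_apply (z.isUnit.map _)]
  · ext a
    obtain ⟨z, hz⟩ := FiniteField.norm_surjective F K (a : F)
    have hz0 : z ≠ 0 := by rintro rfl; simp at hz; exact a.ne_zero hz.symm
    rw [← hz, ← normChar_apply, h, hz, MulChar.one_apply_coe, MulChar.one_apply hz0.isUnit]

theorem jacobiSum_add_jacobiSum (hq : Fintype.card F % 4 = 3) (hK : Module.finrank F K = 2)
    {M : MulChar K ℂ} (hM : orderOf M = 8) (ν E : MulChar F ℂ) :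
    2 * (jacobiSum (normChar K ν * M) (normChar K E) +
      jacobiSum (normChar K ν * M ^ 5) (normChar K E)) =
      ∑ s : K, (phi F * ν ^ 4) (Algebra.norm F s) * E (Algebra.norm F (1 - s ^ 4)) := by
  classical
  have hF := ringChar_ne_two_of_card hq
  have hKc := ringChar_ne_two_of_algebra (K := K) hF
  have h4 := pow_four_eq_phi hM
  set P : K → ℂ := fun w =>
    normChar K ν w ^ 2 * (M ^ 2) w * normChar K E (1 - w ^ 2) with hP
  have h1 : jacobiSum (normChar K ν * M) (normChar K E) +
      jacobiSum (normChar K ν * M ^ 5) (normChar K E) = ∑ w, P w := by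
    have := sum_comp_sq hKc fun z => normChar K ν z * M z * normChar K E (1 - z)
    rw [jacobiSum, jacobiSum, ← Finset.sum_add_distrib]
    refine Eq.trans ?_ (this.symm.trans ?_)
    · refine Finset.sum_congr rfl fun z _ => ?_
      rw [show M ^ 5 = M * M ^ 4 by rw [← pow_succ'], h4, MulChar.mul_apply, MulChar.mul_apply,
        MulChar.mul_apply]
      ring
    · refine Finset.sum_congr rfl fun w _ => ?_
      simp only [hP]
      rw [map_pow, map_pow, MulChar.pow_apply' M two_ne_zero]
  have hσ : ∀ w : K, P (w ^ Fintype.card F) = P w * phi K w := fun w => by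
    have hn : ∀ z : K, Algebra.norm F (z ^ Fintype.card F) = Algebra.norm F z := fun z => by
      rw [map_pow, FiniteField.pow_card]
    have hs : 1 - (w ^ Fintype.card F) ^ 2 = (1 - w ^ 2) ^ Fintype.card F := by
      have := map_sub (FiniteField.frobeniusAlgEquivOfAlgebraic F K) 1 (w ^ 2)
      simp only [FiniteField.coe_frobeniusAlgEquivOfAlgebraic, one_pow] at this
      rw [this, ← pow_mul, ← pow_mul, mul_comm]
    simp only [hP, normChar_apply]
    rw [hs, hn, hn, sq_apply_frobenius hq hK hM]
    ring
  -- Frobenius permutes K, so the factor φ(w) can be inserted freely; averaging restricts the sum to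
  -- squares w = s².
  have h2 : ∑ w, P w * phi K w = ∑ w, P w := by
    rw [← Finset.sum_congr rfl fun w _ => hσ w]
    exact (FiniteField.frobeniusAlgEquivOfAlgebraic F K).toEquiv.sum_comp P
  rw [h1, two_mul]
  nth_rw 2 [← h2]
  rw [← Finset.sum_add_distrib, Finset.sum_congr rfl
    (g := fun w => (1 + phi K w) * P w) fun w _ => by ring, ← sum_comp_sq hKc]
  refine Finset.sum_congr rfl fun s _ => ?_
  simp only [hP, normChar_apply]
  have h5 : (M ^ 2) (s ^ 2) = phi F (Algebra.norm F s) := by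
    rw [← normChar_apply, normChar_phi hF, ← h4, map_pow, ← MulChar.pow_apply' _ two_ne_zero,
      ← pow_mul]
  rw [h5, MulChar.mul_apply, MulChar.pow_apply' ν (by norm_num), ← pow_mul, map_pow, map_pow]
  ring

/-- Coordinates on the quadratic extension given by a square root of `-1`. -/
theorem sum_eq_sum_sum_sqrt_neg_one (hq : Fintype.card F % 4 = 3) (hK : Module.finrank F K = 2) :
    ∃ i : K, i ^ 2 = -1 ∧
      (∀ x y : F, Algebra.norm F (algebraMap F K x + algebraMap F K y * i) = x ^ 2 + y ^ 2) ∧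
      ∀ f : K → ℂ, ∑ s, f s = ∑ x : F, ∑ y : F, f (algebraMap F K x + algebraMap F K y * i) := by
  have hcard := card_eq_sq_of_finrank_eq_two hK
  obtain ⟨i, hi⟩ : IsSquare (-1 : K) := by
    rw [FiniteField.isSquare_neg_one_iff, hcard, Nat.pow_mod, hq]; norm_num
  have hi2 : i ^ 2 = -1 := by rw [hi, sq]
  have hiF : ∀ a : F, algebraMap F K a ≠ i := fun a ha => by
    refine FiniteField.isSquare_neg_one_iff.1 ⟨a, (algebraMap F K).injective ?_⟩ hq
    rw [map_neg, map_one, map_mul, ha, hi]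
  refine ⟨i, hi2, fun x y => (algebraMap F K).injective ?_, fun f => ?_⟩
  · have hiq : i ^ Fintype.card F = -i := by
      rw [← Nat.div_add_mod (Fintype.card F) 4, hq, pow_add, pow_mul,
        show i ^ 4 = 1 by linear_combination (i ^ 2 - 1) * hi2, one_pow]
      linear_combination i * hi2
    have hf := map_add (FiniteField.frobeniusAlgEquivOfAlgebraic F K) (algebraMap F K x)
      (algebraMap F K y * i)
    simp only [FiniteField.coe_frobeniusAlgEquivOfAlgebraic, mul_pow, ← map_pow,
      FiniteField.pow_card, hiq] at hf
    rw [algebraMap_norm_eq_pow_card_add_one hK, pow_succ, hf, map_add, map_pow, map_pow]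
    linear_combination -(algebraMap F K y) ^ 2 * hi2
  · rw [← Fintype.sum_prod_type']
    have hinj : Function.Injective
        fun v : F × F => algebraMap F K v.1 + algebraMap F K v.2 * i := by
      rintro ⟨x, y⟩ ⟨x', y'⟩ h
      simp only at h
      have hy : y = y' := by
        by_contra hne
        have h0 : algebraMap F K y' - algebraMap F K y ≠ 0 := by
          rw [← map_sub]; simpa [sub_eq_zero] using Ne.symm hne
        refine hiF ((x - x') / (y' - y)) ?_
        rw [map_div₀, map_sub, map_sub, div_eq_iff h0]
        linear_combination h
      subst hy
      simpa using h
    refine (Function.Bijective.sum_comp ((Fintype.bijective_iff_injective_and_card _).2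
      ⟨hinj, ?_⟩) f).symm
    rw [Fintype.card_prod, hcard, sq]

theorem sum_norm_eq_sum_sum (hq : Fintype.card F % 4 = 3) (hK : Module.finrank F K = 2)
    (χ E : MulChar F ℂ) :
    ∑ s : K, χ (Algebra.norm F s) * E (Algebra.norm F (1 - s ^ 4)) =
      ∑ x : F, ∑ y : F, χ (x ^ 2 + y ^ 2) *
        E ((1 + (x ^ 2 + y ^ 2) ^ 2) ^ 2 - 4 * (x ^ 2 - y ^ 2) ^ 2) := by
  obtain ⟨i, hi, hN, hsum⟩ := sum_eq_sum_sum_sqrt_neg_one (F := F) (K := K) hq hK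
  rw [hsum]
  refine Finset.sum_congr rfl fun x _ => Finset.sum_congr rfl fun y _ => ?_
  -- Factor as (1 − s²)(1 + s²), so that the norm is read off from sums of two squares.
  have h : 1 - (algebraMap F K x + algebraMap F K y * i) ^ 4 =
      (algebraMap F K (1 - (x ^ 2 - y ^ 2)) + algebraMap F K (-(2 * x * y)) * i) *
        (algebraMap F K (1 + (x ^ 2 - y ^ 2)) + algebraMap F K (2 * x * y) * i) := by
    have h2 : (algebraMap F K x + algebraMap F K y * i) ^ 2 =
        algebraMap F K (x ^ 2 - y ^ 2) + algebraMap F K (2 * x * y) * i := by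
      simp only [map_sub, map_mul, map_pow, map_ofNat]
      linear_combination (algebraMap F K y) ^ 2 * hi
    rw [show (4 : ℕ) = 2 * 2 from rfl, pow_mul, h2]
    simp only [map_add, map_sub, map_neg, map_one]
    ring
  rw [h, map_mul, hN, hN, hN]
  congr 2
  ring

end Extension

/-! ### Descent to sums over F and conclusion. -/

/-- Expand (1 + φ(x))(1 + φ(y)): negating both variables kills 1 + φ(x)φ(y), since H is odd, and
symmetry equates the two remaining terms. -/
theorem sum_sum_odd_symmetric {F : Type*} [Field F] [Fintype F] [DecidableEq F]
    (hq : Fintype.card F % 4 = 3) (H : F → F → ℂ) (hsymm : ∀ x y, H x y = H y x)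
    (hodd : ∀ x y, H (-x) (-y) = -H x y) :
    ∑ x : F, ∑ y : F, H (x ^ 2) (y ^ 2) = 2 * ∑ x : F, ∑ y : F, phi F x * H x y := by
  have hF := ringChar_ne_two_of_card hq
  have h1 : ∑ x : F, ∑ y : F, H (x ^ 2) (y ^ 2) =
      ∑ x : F, ∑ y : F, (1 + phi F x) * ((1 + phi F y) * H x y) := by
    rw [sum_comp_sq hF fun x => ∑ y : F, H x (y ^ 2)]
    refine Finset.sum_congr rfl fun x _ => ?_
    rw [sum_comp_sq hF fun y => H x y, Finset.mul_sum]
  have h2 : ∑ x : F, ∑ y : F, phi F y * H x y = ∑ x : F, ∑ y : F, phi F x * H x y := by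
    rw [Finset.sum_comm]
    simp only [hsymm]
  have h3 : ∑ x : F, ∑ y : F, (1 + phi F x * phi F y) * H x y = 0 := by
    rw [← CharZero.eq_neg_self_iff, ← Finset.sum_neg_distrib]
    refine (Equiv.sum_comp (Equiv.neg F) _).symm.trans (Finset.sum_congr rfl fun x _ => ?_)
    rw [← Finset.sum_neg_distrib]
    refine (Equiv.sum_comp (Equiv.neg F) _).symm.trans ?_
    refine Finset.sum_congr rfl fun y _ => ?_
    simp only [Equiv.neg_apply, hodd, phi_neg hq]
    ring
  rw [h1, two_mul]
  nth_rw 2 [← h2]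
  rw [← add_zero (_ + _), ← h3]
  simp only [← Finset.sum_add_distrib]
  refine Finset.sum_congr rfl fun x _ => Finset.sum_congr rfl fun y _ => ?_
  ring

theorem jacobiSum_add_jacobiSum_eq_sum {F K : Type*} [Field F] [Fintype F] [DecidableEq F]
    [Field K] [Fintype K] [Algebra F K] (hq : Fintype.card F % 4 = 3)
    (hK : Module.finrank F K = 2) {M : MulChar K ℂ} (hM : orderOf M = 8) (ν E : MulChar F ℂ) :
    jacobiSum (normChar K ν * M) (normChar K E) +
      jacobiSum (normChar K ν * M ^ 5) (normChar K E) =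
      ∑ j : Fˣ, (phi F * ν ^ 4) j *
        ∑ x : F, phi F x * E ((1 + (j : F) ^ 2) ^ 2 - 4 * (2 * x - j) ^ 2) := by
  have h := jacobiSum_add_jacobiSum hq hK hM ν E
  rw [sum_norm_eq_sum_sum hq hK, sum_sum_odd_symmetric hq (fun x y => (phi F * ν ^ 4) (x + y) *
    E ((1 + (x + y) ^ 2) ^ 2 - 4 * (x - y) ^ 2))] at h
  · rw [mul_left_cancel₀ two_ne_zero h, sum_units_eq_sum (fun j : F => (phi F * ν ^ 4) j *
      ∑ x : F, phi F x * E ((1 + j ^ 2) ^ 2 - 4 * (2 * x - j) ^ 2)) (by simp [MulChar.map_zero])]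
    simp only [Finset.mul_sum]
    rw [Finset.sum_comm (γ := F) (α := F) (f := fun j x => (phi F * ν ^ 4) j *
      (phi F x * E ((1 + j ^ 2) ^ 2 - 4 * (2 * x - j) ^ 2)))]
    refine Finset.sum_congr rfl fun x _ => ?_
    -- Substitute y = j − x, so x − y = 2x − j.
    rw [← (Equiv.subRight x).sum_comp]
    refine Finset.sum_congr rfl fun j _ => ?_
    simp only [Equiv.subRight_apply]
    rw [add_sub_cancel, show x - (j - x) = 2 * x - j by ring]
    ring
  · intro x y
    rw [add_comm y x, show (y - x) ^ 2 = (x - y) ^ 2 by ring]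
  · intro x y
    rw [← neg_add, neg_sq, show (-x - -y) ^ 2 = (x - y) ^ 2 by ring, MulChar.mul_apply,
      MulChar.mul_apply, phi_neg hq, show ν ^ 4 = ν ^ (2 * 2) from rfl,
      mulChar_pow_two_mul_apply_neg]
    ring

theorem theorem5p3 {F K : Type*} [Field F] [Fintype F] [DecidableEq F] [Field K] [Fintype K]
    [Algebra F K] (p : ℕ) [Fact p.Prime] [Algebra (ZMod p) F]
    (hq : Fintype.card F % 4 = 3) (hK : Module.finrank F K = 2)
    (M₈ : MulChar K ℂ) (hM₈ : orderOf M₈ = 8) (ν₁ : MulChar F ℂ) :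
    wSum ν₁ 1 = 2 ∧
    ∀ D : MulChar F ℂ, D ≠ 1 →
      wSum ν₁ D =
        -(gaussG p (phi F) * gaussG p D ^ 2) /
            ((Fintype.card F : ℂ) * gaussG p (phi F * D ^ 2)) *
          (jacobiSum (normChar K ν₁ * M₈) (normChar K D⁻¹) +
            jacobiSum (normChar K ν₁ * M₈ ^ 5) (normChar K D⁻¹)) := by
  refine ⟨wSum_one hq ν₁, fun D hD => ?_⟩
  rw [jacobiSum_add_jacobiSum_eq_sum hq hK hM₈, wSum, Finset.mul_sum]
  refine Finset.sum_congr rfl fun j _ => ?_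
  rw [hSum_eq hq (psi_isPrimitive p F) hD]
  simp only [gaussG]
  ring
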